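/- **Theorem (Cut admissibility).** Formulas are generated by $A ::= p_i \mid \bot \mid A\land A \mid A\lor A \mid A\to A \mid \Box A \mid \Diamond A$ from countably many propositional variables. A (single-succedent) sequent $\Gamma\Rightarrow\Delta$ consists of a finite, possibly empty multiset $\Gamma$ of formulas and a $\Delta$ that is empty or a single formula; $\Box\Gamma$ denotes the multiset of all $\Box A$ with $A$ in $\Gamma$. Below, $\Gamma,\Gamma'$ are arbitrary finite multisets (possibly empty), $|\Delta|\le 1$, $p$ is a propositional variable, and "premisses / conclusion" denotes a rule. Propositional rules: - initial sequents $\Gamma,p\Rightarrow p$ and $\Gamma,\bot\Rightarrow\Delta$; - $\Gamma,A\to B\Rightarrow A$ and $\Gamma,B\Rightarrow\Delta$ / $\Gamma,A\to B\Rightarrow\Delta$; $\quad\Gamma,A\Rightarrow B$ / $\Gamma\Rightarrow A\to B$; - $\Gamma,A,B\Rightarrow\Delta$ / $\Gamma,A\land B\Rightarrow\Delta$; $\quad\Gamma\Rightarrow A$ and $\Gamma\Rightarrow B$ / $\Gamma\Rightarrow A\land B$; - $\Gamma,A\Rightarrow\Delta$ and $\Gamma,B\Rightarrow\Delta$ /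 $\Gamma,A\lor B\Rightarrow\Delta$; $\quad\Gamma\Rightarrow A_i$ / $\Gamma\Rightarrow A_1\lor A_2$ ($i\in\{1,2\}$). Modal rules: - $M_\Box$: $A\Rightarrow B$ / $\Gamma,\Box A\Rightarrow\Box B$; $\quad M_\Diamond$: $A\Rightarrow B$ / $\Gamma,\Diamond A\Rightarrow\Diamond B$; $\quad \mathrm{dual}_M$: $A,B\Rightarrow$ / $\Gamma,\Box A,\Diamond B\Rightarrow\Delta$; - $N_\Box$: $\Rightarrow A$ / $\Gamma\Rightarrow\Box A$; $\quad N_\Diamond$: $A\Rightarrow$ / $\Gamma,\Diamond A\Rightarrow\Delta$; - $C_\Box$: $\Gamma,A\Rightarrow B$ / $\Gamma',\Box\Gamma,\Box A\Rightarrow\Box B$; $\quad C_\Diamond$: $\Gamma,A\Rightarrow B$ / $\Gamma',\Box\Gamma,\Diamond A\Rightarrow\Diamond B$; $\quad \mathrm{dual}_C$: $\Gamma,A,B\Rightarrow$ / $\Gamma',\Box\Gamma,\Box A,\Diamond B\Rightarrow\Delta$; - $K_\Box$: $\Gamma\Rightarrow A$ / $\Gamma',\Box\Gamma\Rightarrow\Box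 A$; $\quad K_\Diamond$: $\Gamma,A\Rightarrow B$ / $\Gamma',\Box\Gamma,\Diamond A\Rightarrow\Diamond B$; $\quad \mathrm{dual}_K$: $\Gamma,A\Rightarrow$ / $\Gamma',\Box\Gamma,\Diamond A\Rightarrow\Delta$; - $P_\Box$: $A\Rightarrow$ / $\Gamma,\Box A\Rightarrow\Delta$; $\quad P_\Diamond$: $\Rightarrow A$ / $\Gamma\Rightarrow\Diamond A$; - $D$: $A\Rightarrow B$ / $\Gamma,\Box A\Rightarrow\Diamond B$; $\quad D_\Box$: $A,B\Rightarrow$ / $\Gamma,\Box A,\Box B\Rightarrow\Delta$; - $CD$: $\Gamma\Rightarrow A$ / $\Gamma',\Box\Gamma\Rightarrow\Diamond A$; $\quad CD_\Box$: $\Gamma\Rightarrow$ / $\Gamma',\Box\Gamma\Rightarrow\Delta$; - $T_\Box$: $\Gamma,\Box A,A\Rightarrow\Delta$ / $\Gamma,\Box A\Rightarrow\Delta$; $\quad T_\Diamond$: $\Gamma\Rightarrow A$ / $\Gamma\Rightarrow\Diamond A$. The fourteen single-succedent W-calculi consist of the propositional rules together with the following modal rules: - $\mathsf{G.WM}$: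 $M_\Box, M_\Diamond, \mathrm{dual}_M$; $\quad\mathsf{G.WMN}$: those of $\mathsf{G.WM}$ and $N_\Box,N_\Diamond$; - $\mathsf{G.WMC}$: $C_\Box,C_\Diamond,\mathrm{dual}_C$; $\quad\mathsf{G.WK}$: $K_\Box,K_\Diamond,\mathrm{dual}_K$; - $\mathsf{G.WMP}$, $\mathsf{G.WMNP}$: those of $\mathsf{G.WM}$, $\mathsf{G.WMN}$, respectively, and $P_\Box,P_\Diamond$; - $\mathsf{G.WMD}$, $\mathsf{G.WMND}$: those of $\mathsf{G.WM}$, $\mathsf{G.WMN}$, respectively, and $D,D_\Box,P_\Box,P_\Diamond$; - $\mathsf{G.WMCD}$, $\mathsf{G.WKD}$: those of $\mathsf{G.WMC}$, $\mathsf{G.WK}$, respectively, and $CD,CD_\Box$; - $\mathsf{G.WMT}$, $\mathsf{G.WMNT}$, $\mathsf{G.WMCT}$, $\mathsf{G.WKT}$: those of $\mathsf{G.WM}$, $\mathsf{G.WMN}$, $\mathsf{G.WMC}$, $\mathsf{G.WK}$, respectively, and $T_\Box,T_\Diamond$. Then the cut rule is admissible in each of these fourteen calculi: for all finite multisets $\Gamma,\Gamma'$,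 every formula $A$ and every $\Delta$ with $|\Delta|\le1$, if $\Gamma\Rightarrow A$ and $\Gamma',A\Rightarrow\Delta$ are derivable in the calculus, then $\Gamma,\Gamma'\Rightarrow\Delta$ is derivable in it (without cut). -/

import Mathlib

namespace WCalculus

/-- Formulas of the propositional modal language over the variables `p_0, p_1, p_2, …`. -/
inductive Formula : Type
  | var : ℕ → Formula
  | bot : Formula
  | and : Formula → Formula → Formula
  | or : Formula → Formula → Formula
  | imp : Formula → Formula → Formula
  | box : Formula → Formula
  | dia : Formula → Formula

open Formula

/-- Single-succedent sequents `Γ ⇒ Δ`: `Γ` is a finite multiset of formulas and `Δ` consists of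
at most one formula (`none` is the empty consequent). -/
structure Sequent : Type where
  ante : Multiset Formula
  succ : Option Formula

/-- The multiset `□Γ`. -/
def boxes (Γ : Multiset Formula) : Multiset Formula := Γ.map box

/-- Names of the modal rules. -/
inductive ModalRule : Type
  | Mbox | Mdia | dualM
  | Nbox | Ndia
  | Cbox | Cdia | dualC
  | Kbox | Kdia | dualK
  | Pbox | Pdia
  | D | Dbox
  | CD | CDbox
  | Tbox | Tdia

/-- `ModalInst r S T`: the inference from the single premiss `S` to the conclusion `T` is an
instance of the modal rule `r`. -/
inductive ModalInst : ModalRule → Sequent → Sequent → Prop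
  | Mbox (Γ : Multiset Formula) (A B : Formula) :
      ModalInst .Mbox ⟨{A}, some B⟩ ⟨box A ::ₘ Γ, some (box B)⟩
  | Mdia (Γ : Multiset Formula) (A B : Formula) :
      ModalInst .Mdia ⟨{A}, some B⟩ ⟨dia A ::ₘ Γ, some (dia B)⟩
  | dualM (Γ : Multiset Formula) (A B : Formula) (Δ : Option Formula) :
      ModalInst .dualM ⟨{A, B}, none⟩ ⟨box A ::ₘ dia B ::ₘ Γ, Δ⟩
  | Nbox (Γ : Multiset Formula) (A : Formula) :
      ModalInst .Nbox ⟨0, some A⟩ ⟨Γ, some (box A)⟩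
  | Ndia (Γ : Multiset Formula) (A : Formula) (Δ : Option Formula) :
      ModalInst .Ndia ⟨{A}, none⟩ ⟨dia A ::ₘ Γ, Δ⟩
  | Cbox (Γ Γ' : Multiset Formula) (A B : Formula) :
      ModalInst .Cbox ⟨A ::ₘ Γ, some B⟩ ⟨box A ::ₘ (boxes Γ + Γ'), some (box B)⟩
  | Cdia (Γ Γ' : Multiset Formula) (A B : Formula) :
      ModalInst .Cdia ⟨A ::ₘ Γ, some B⟩ ⟨dia A ::ₘ (boxes Γ + Γ'), some (dia B)⟩
  | dualC (Γ Γ' : Multiset Formula) (A B : Formula) (Δ : Option Formula) :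
      ModalInst .dualC ⟨A ::ₘ B ::ₘ Γ, none⟩ ⟨box A ::ₘ dia B ::ₘ (boxes Γ + Γ'), Δ⟩
  | Kbox (Γ Γ' : Multiset Formula) (A : Formula) :
      ModalInst .Kbox ⟨Γ, some A⟩ ⟨boxes Γ + Γ', some (box A)⟩
  | Kdia (Γ Γ' : Multiset Formula) (A B : Formula) :
      ModalInst .Kdia ⟨A ::ₘ Γ, some B⟩ ⟨dia A ::ₘ (boxes Γ + Γ'), some (dia B)⟩
  | dualK (Γ Γ' : Multiset Formula) (A : Formula) (Δ : Option Formula) :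
      ModalInst .dualK ⟨A ::ₘ Γ, none⟩ ⟨dia A ::ₘ (boxes Γ + Γ'), Δ⟩
  | Pbox (Γ : Multiset Formula) (A : Formula) (Δ : Option Formula) :
      ModalInst .Pbox ⟨{A}, none⟩ ⟨box A ::ₘ Γ, Δ⟩
  | Pdia (Γ : Multiset Formula) (A : Formula) :
      ModalInst .Pdia ⟨0, some A⟩ ⟨Γ, some (dia A)⟩
  | D (Γ : Multiset Formula) (A B : Formula) :
      ModalInst .D ⟨{A}, some B⟩ ⟨box A ::ₘ Γ, some (dia B)⟩
  | Dbox (Γ : Multiset Formula) (A B : Formula) (Δ : Option Formula) :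
      ModalInst .Dbox ⟨{A, B}, none⟩ ⟨box A ::ₘ box B ::ₘ Γ, Δ⟩
  | CD (Γ Γ' : Multiset Formula) (A : Formula) :
      ModalInst .CD ⟨Γ, some A⟩ ⟨boxes Γ + Γ', some (dia A)⟩
  | CDbox (Γ Γ' : Multiset Formula) (Δ : Option Formula) :
      ModalInst .CDbox ⟨Γ, none⟩ ⟨boxes Γ + Γ', Δ⟩
  | Tbox (Γ : Multiset Formula) (A : Formula) (Δ : Option Formula) :
      ModalInst .Tbox ⟨A ::ₘ box A ::ₘ Γ, Δ⟩ ⟨box A ::ₘ Γ, Δ⟩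
  | Tdia (Γ : Multiset Formula) (A : Formula) :
      ModalInst .Tdia ⟨Γ, some A⟩ ⟨Γ, some (dia A)⟩

/-- The fourteen W-logics (`M` stands for `WM`, and so on). -/
inductive WLogic : Type
  | M | MN | MC | K
  | MP | MNP
  | MD | MND | MCD | KD
  | MT | MNT | MCT | KT

/-- The modal rules of the calculus `G.WL`. -/
def modalRules : WLogic → Set ModalRule
  | .M => {.Mbox, .Mdia, .dualM}
  | .MN => {.Mbox, .Mdia, .dualM, .Nbox, .Ndia}
  | .MC => {.Cbox, .Cdia, .dualC}
  | .K => {.Kbox, .Kdia, .dualK}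
  | .MP => {.Mbox, .Mdia, .dualM, .Pbox, .Pdia}
  | .MNP => {.Mbox, .Mdia, .dualM, .Nbox, .Ndia, .Pbox, .Pdia}
  | .MD => {.Mbox, .Mdia, .dualM, .D, .Dbox, .Pbox, .Pdia}
  | .MND => {.Mbox, .Mdia, .dualM, .Nbox, .Ndia, .D, .Dbox, .Pbox, .Pdia}
  | .MCD => {.Cbox, .Cdia, .dualC, .CD, .CDbox}
  | .KD => {.Kbox, .Kdia, .dualK, .CD, .CDbox}
  | .MT => {.Mbox, .Mdia, .dualM, .Tbox, .Tdia}
  | .MNT => {.Mbox, .Mdia, .dualM, .Nbox, .Ndia, .Tbox, .Tdia}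
  | .MCT => {.Cbox, .Cdia, .dualC, .Tbox, .Tdia}
  | .KT => {.Kbox, .Kdia, .dualK, .Tbox, .Tdia}

/-- `Derivable L S`: the sequent `S` has a derivation in the calculus `G.WL`, which consists of the
intuitionistic propositional rules and the modal rules in `modalRules L`. There is no cut rule
and there are no structural rules. -/
inductive Derivable (L : WLogic) : Sequent → Prop
  | init (Γ : Multiset Formula) (p : ℕ) : Derivable L ⟨var p ::ₘ Γ, some (var p)⟩
  | botL (Γ : Multiset Formula) (Δ : Option Formula) : Derivable L ⟨bot ::ₘ Γ, Δ⟩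
  | impL (Γ : Multiset Formula) (A B : Formula) (Δ : Option Formula) :
      Derivable L ⟨imp A B ::ₘ Γ, some A⟩ → Derivable L ⟨B ::ₘ Γ, Δ⟩ →
        Derivable L ⟨imp A B ::ₘ Γ, Δ⟩
  | impR (Γ : Multiset Formula) (A B : Formula) :
      Derivable L ⟨A ::ₘ Γ, some B⟩ → Derivable L ⟨Γ, some (imp A B)⟩
  | andL (Γ : Multiset Formula) (A B : Formula) (Δ : Option Formula) :
      Derivable L ⟨A ::ₘ B ::ₘ Γ, Δ⟩ → Derivable L ⟨and A B ::ₘ Γ, Δ⟩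
  | andR (Γ : Multiset Formula) (A B : Formula) :
      Derivable L ⟨Γ, some A⟩ → Derivable L ⟨Γ, some B⟩ → Derivable L ⟨Γ, some (and A B)⟩
  | orL (Γ : Multiset Formula) (A B : Formula) (Δ : Option Formula) :
      Derivable L ⟨A ::ₘ Γ, Δ⟩ → Derivable L ⟨B ::ₘ Γ, Δ⟩ → Derivable L ⟨or A B ::ₘ Γ, Δ⟩
  | orR₁ (Γ : Multiset Formula) (A B : Formula) :
      Derivable L ⟨Γ, some A⟩ → Derivable L ⟨Γ, some (or A B)⟩
  | orR₂ (Γ : Multiset Formula) (A B : Formula) :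
      Derivable L ⟨Γ, some B⟩ → Derivable L ⟨Γ, some (or A B)⟩
  | modal (r : ModalRule) (S T : Sequent) :
      r ∈ modalRules L → ModalInst r S T → Derivable L S → Derivable L T

/-- A rule, given by its instances (list of premisses, conclusion), is admissible in `G.WL` if
the conclusion of each instance is derivable whenever all its premisses are. -/
def Admissible (L : WLogic) (R : List Sequent → Sequent → Prop) : Prop :=
  ∀ (P : List Sequent) (T : Sequent), R P T → (∀ S ∈ P, Derivable L S) → Derivable L T

/-- The cut rule: from `Γ ⇒ A` and `Γ', A ⇒ Δ` infer `Γ, Γ' ⇒ Δ`. -/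
inductive Cut : List Sequent → Sequent → Prop
  | mk (Γ Γ' : Multiset Formula) (A : Formula) (Δ : Option Formula) :
      Cut [⟨Γ, some A⟩, ⟨A ::ₘ Γ', Δ⟩] ⟨Γ + Γ', Δ⟩

end WCalculus

/-!
Cut is proved admissible by passing to an auxiliary calculus `Der` in which contraction costs
nothing. Its antecedents are *sets* of formulas, its left rules keep the principal formula in the
premisses, and the non-reflexive modal rules are merged into a single rule: from `X, Y ⇒ δ` infer
`Γ ⇒ Δ`, where `□X ∪ ◇Y ⊆ Γ` and `Δ` is `δ` with a modality in front (or anything, if `δ` is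
empty). The logics differ only in the admitted values of `|X|`, `|Y|` and the shape of `Δ`,
recorded by `Prof`.

In `Der`, cut with shared context is eliminated by induction on the cut formula, then on the
derivation of the left premiss (`cutFor_of_intro`), then on that of the right premiss
(`cut_of_intro`). Since weakening holds by monotonicity (`Der.mono`), no derivation heights are
needed. When both premisses are modal, a cut on the immediate subformula gives the premiss of a new
instance of the merged modal rule; that this instance belongs to the same logic is exactly the
closure of `Prof` under composition (`Prof.comp_box`, `Prof.comp_dia`). This is the point where it
matters which modal rules are put together in each of the fourteen calculi. With the reflexive
rules, the boxes of a modal premiss are absorbed by `T_□` (`Der.Tbox_finset`).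

It remains to compare the two calculi. `Derivable` embeds into `Der` rule by rule
(`Derivable.der`). The converse (`Der.derivable`) would ordinarily require invertibility of the left
rules and contraction in the multiset calculus. Instead one shows, by a single induction on
`Der L Γ Δ`, that `Γ' ⇒ Δ` is derivable for every multiset `Γ'` that *covers* `Γ`: each formula of
`Γ` is either in `Γ'` or has already been decomposed by left rules into formulas of `Γ'`. The
retained copies of a principal formula are covered by its components, so they do no harm.
-/

namespace WCalculus

open Formula

/-! ### Profiles of modal rules -/

noncomputable instance : DecidableEq Formula := Classical.decEq _

/-- The shape of the consequent of a modal inference: `none` for rules whose premiss has empty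
consequent, `box` and `dia` for rules introducing `□` or `◇` on the right. -/
inductive Kind : Type
  | none | box | dia

/-- `Lift k δ Δ`: a modal inference of kind `k` takes the consequent `δ` of its premiss to the
consequent `Δ` of its conclusion. -/
inductive Lift : Kind → Option Formula → Option Formula → Prop
  | none (Δ : Option Formula) : Lift .none none Δ
  | box (B : Formula) : Lift .box (some B) (some (box B))
  | dia (B : Formula) : Lift .dia (some B) (some (dia B))

/-- `Prof L m d k`: the logic `L` admits the inference of kind `k` from `X, Y ⇒ δ` to
`Γ, □X, ◇Y ⇒ Δ` with `|X| = m` and `|Y| = d`. The reflexive rules `T_□`, `T_◇` are not of this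
form and are left out. The case `m = d = 0` of kind `none` is always admitted: it is weakening of
a derivable empty sequent, and it arises by composing `N_□` with `P_□`, for instance. -/
def Prof (L : WLogic) (m : ℕ) : ℕ → Kind → Prop
  | 0, .box => (.Mbox ∈ modalRules L ∧ m = 1) ∨ (.Nbox ∈ modalRules L ∧ m = 0) ∨
      (.Cbox ∈ modalRules L ∧ 1 ≤ m) ∨ .Kbox ∈ modalRules L
  | 0, .dia => (.Pdia ∈ modalRules L ∧ m = 0) ∨ (.D ∈ modalRules L ∧ m = 1) ∨
      .CD ∈ modalRules L
  | 0, .none => m = 0 ∨ (.Pbox ∈ modalRules L ∧ m = 1) ∨ (.Dbox ∈ modalRules L ∧ m = 2) ∨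
      .CDbox ∈ modalRules L
  | 1, .dia => (.Mdia ∈ modalRules L ∧ m = 0) ∨ .Cdia ∈ modalRules L ∨ .Kdia ∈ modalRules L
  | 1, .none => (.dualM ∈ modalRules L ∧ m = 1) ∨ (.Ndia ∈ modalRules L ∧ m = 0) ∨
      (.dualC ∈ modalRules L ∧ 1 ≤ m) ∨ .dualK ∈ modalRules L
  | _, _ => False

theorem Prof.card_dia_le {L : WLogic} {m d : ℕ} {k : Kind} (h : Prof L m d k) : d ≤ 1 := by
  match d, k, h with
  | 0, _, _ => omega
  | 1, _, _ => omega
  | d + 2, _, h => simp [Prof] at h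

theorem Prof.box_card_dia {L : WLogic} {m d : ℕ} (h : Prof L m d .box) : d = 0 := by
  match d, h with
  | 0, _ => rfl
  | d + 1, h => simp [Prof] at h

/-- Composition of modal inferences along a cut on `□B`: the left premiss contributes `a` boxes, and
`m'` is the number of distinct boxes when `B` is replaced by them among the `m` boxes on the
right. -/
theorem Prof.comp_box {L : WLogic} {a m m' d : ℕ} {k : Kind} (hl : Prof L a 0 .box)
    (hr : Prof L m d k) (hm : 1 ≤ m) (h₁ : a ≤ m') (h₂ : m' ≤ m - 1 + a) :
    Prof L m' d k := by
  have hd := hr.card_dia_le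
  interval_cases d <;> cases k <;> cases L <;> simp [Prof, modalRules] at hl hr ⊢ <;> omega

/-- Composition of modal inferences along a cut on `◇B`; the only diamond of the right premiss is
replaced by the `a` boxes and `c` diamonds of the left premiss. -/
theorem Prof.comp_dia {L : WLogic} {a c m m' : ℕ} {k : Kind} (hl : Prof L a c .dia)
    (hr : Prof L m 1 k) (h₁ : m ≤ m') (h₂ : a ≤ m') (h₃ : m' ≤ m + a) :
    Prof L m' c k := by
  have hd := hl.card_dia_le
  interval_cases c <;> cases k <;> cases L <;> simp [Prof, modalRules] at hl hr ⊢ <;> omega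

/-- Contracting the two boxes of `D_□` requires `P_□`. -/
theorem Pbox_mem_of_Dbox_mem {L : WLogic} (h : .Dbox ∈ modalRules L) : .Pbox ∈ modalRules L := by
  cases L <;> simp [modalRules] at h ⊢

theorem Tbox_mem_of_Tdia_mem {L : WLogic} (h : .Tdia ∈ modalRules L) : .Tbox ∈ modalRules L := by
  cases L <;> simp [modalRules] at h ⊢

/-! ### The set-based calculus -/

/-- The calculus with sets as antecedents, principal formulas retained in the premisses of left
rules, and one modal rule for all profiles besides the reflexive rules. -/
inductive Der (L : WLogic) : Set Formula → Option Formula → Prop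
  | init {Γ : Set Formula} {p : ℕ} : var p ∈ Γ → Der L Γ (some (var p))
  | botL {Γ : Set Formula} {Δ : Option Formula} : bot ∈ Γ → Der L Γ Δ
  | impL {Γ : Set Formula} {A B : Formula} {Δ : Option Formula} : imp A B ∈ Γ →
      Der L Γ (some A) → Der L (insert B Γ) Δ → Der L Γ Δ
  | impR {Γ : Set Formula} {A B : Formula} : Der L (insert A Γ) (some B) →
      Der L Γ (some (imp A B))
  | andL {Γ : Set Formula} {A B : Formula} {Δ : Option Formula} : and A B ∈ Γ →
      Der L (insert A (insert B Γ)) Δ → Der L Γ Δ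
  | andR {Γ : Set Formula} {A B : Formula} : Der L Γ (some A) → Der L Γ (some B) →
      Der L Γ (some (and A B))
  | orL {Γ : Set Formula} {A B : Formula} {Δ : Option Formula} : or A B ∈ Γ →
      Der L (insert A Γ) Δ → Der L (insert B Γ) Δ → Der L Γ Δ
  | orR₁ {Γ : Set Formula} {A B : Formula} : Der L Γ (some A) → Der L Γ (some (or A B))
  | orR₂ {Γ : Set Formula} {A B : Formula} : Der L Γ (some B) → Der L Γ (some (or A B))
  | modal {Γ : Set Formula} {Δ : Option Formula} (X Y : Finset Formula) (k : Kind)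
      (δ : Option Formula) : Prof L X.card Y.card k → Lift k δ Δ →
      (∀ A ∈ X, box A ∈ Γ) → (∀ A ∈ Y, dia A ∈ Γ) → Der L (↑X ∪ ↑Y) δ → Der L Γ Δ
  | Tbox {Γ : Set Formula} {A : Formula} {Δ : Option Formula} : .Tbox ∈ modalRules L →
      box A ∈ Γ → Der L (insert A Γ) Δ → Der L Γ Δ
  | Tdia {Γ : Set Formula} {A : Formula} : .Tdia ∈ modalRules L → Der L Γ (some A) →
      Der L Γ (some (dia A))

namespace Der

variable {L : WLogic}

theorem mono {Γ : Set Formula} {Δ : Option Formula} (h : Der L Γ Δ) :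
    ∀ {Γ' : Set Formula}, Γ ⊆ Γ' → Der L Γ' Δ := by
  induction h with
  | init h => intro Γ' hs; exact .init (hs h)
  | botL h => intro Γ' hs; exact .botL (hs h)
  | impL h _ _ ih₁ ih₂ =>
    intro Γ' hs; exact .impL (hs h) (ih₁ hs) (ih₂ (Set.insert_subset_insert hs))
  | impR _ ih => intro Γ' hs; exact .impR (ih (Set.insert_subset_insert hs))
  | andL h _ ih =>
    intro Γ' hs; exact .andL (hs h) (ih (Set.insert_subset_insert (Set.insert_subset_insert hs)))
  | andR _ _ ih₁ ih₂ => intro Γ' hs; exact .andR (ih₁ hs) (ih₂ hs)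
  | orL h _ _ ih₁ ih₂ =>
    intro Γ' hs
    exact .orL (hs h) (ih₁ (Set.insert_subset_insert hs)) (ih₂ (Set.insert_subset_insert hs))
  | orR₁ _ ih => intro Γ' hs; exact .orR₁ (ih hs)
  | orR₂ _ ih => intro Γ' hs; exact .orR₂ (ih hs)
  | modal X Y k δ hp hl hX hY h _ =>
    intro Γ' hs; exact .modal X Y k δ hp hl (fun A hA => hs (hX A hA)) (fun A hA => hs (hY A hA)) h
  | Tbox hT h _ ih => intro Γ' hs; exact .Tbox hT (hs h) (ih (Set.insert_subset_insert hs))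
  | Tdia hT _ ih => intro Γ' hs; exact .Tdia hT (ih hs)

theorem weaken_succ {Γ : Set Formula} (h : Der L Γ none) (Δ : Option Formula) : Der L Γ Δ := by
  generalize hN : (none : Option Formula) = N at h
  induction h with
  | init | impR | andR | orR₁ | orR₂ | Tdia => cases hN
  | botL h => exact .botL h
  | impL h h₁ _ _ ih₂ => exact .impL h h₁ (ih₂ hN)
  | andL h _ ih => exact .andL h (ih hN)
  | orL h _ _ ih₁ ih₂ => exact .orL h (ih₁ hN) (ih₂ hN)
  | modal X Y k δ hp hl hX hY h _ =>
    subst hN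
    cases hl
    exact .modal X Y .none none hp (.none Δ) hX hY h
  | Tbox hT h _ ih => exact .Tbox hT h (ih hN)

/-- Iterated `T_□`. -/
theorem Tbox_finset (hT : .Tbox ∈ modalRules L) {Γ : Set Formula} {Δ : Option Formula}
    (X : Finset Formula) : (∀ A ∈ X, box A ∈ Γ) → Der L (↑X ∪ Γ) Δ → Der L Γ Δ := by
  induction X using Finset.induction_on with
  | empty => intro _ h; simpa using h
  | insert A X _ ih =>
    intro hX h
    refine ih (fun B hB => hX B (Finset.mem_insert_of_mem hB)) ?_
    refine .Tbox hT (Or.inr (hX A (Finset.mem_insert_self A X))) ?_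
    rwa [Finset.coe_insert, Set.insert_union] at h

end Der

/-! ### Cut elimination in the set-based calculus -/

/-- `Intro L Γ A`: the sequent `Γ ⇒ A` is the conclusion of an inference in which the consequent `A`
is principal, with derivable premisses. -/
inductive Intro (L : WLogic) (Γ : Set Formula) : Formula → Prop
  | var {p : ℕ} : var p ∈ Γ → Intro L Γ (var p)
  | imp {A B : Formula} : Der L (insert A Γ) (some B) → Intro L Γ (imp A B)
  | and {A B : Formula} : Der L Γ (some A) → Der L Γ (some B) → Intro L Γ (and A B)
  | or₁ {A B : Formula} : Der L Γ (some A) → Intro L Γ (or A B)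
  | or₂ {A B : Formula} : Der L Γ (some B) → Intro L Γ (or A B)
  | box {B : Formula} (X Y : Finset Formula) : Prof L X.card Y.card .box →
      (∀ A ∈ X, box A ∈ Γ) → (∀ A ∈ Y, dia A ∈ Γ) → Der L (↑X ∪ ↑Y) (some B) →
      Intro L Γ (box B)
  | dia {B : Formula} (X Y : Finset Formula) : Prof L X.card Y.card .dia →
      (∀ A ∈ X, Formula.box A ∈ Γ) → (∀ A ∈ Y, Formula.dia A ∈ Γ) →
      Der L (↑X ∪ ↑Y) (some B) → Intro L Γ (dia B)
  | Tdia {A : Formula} : .Tdia ∈ modalRules L → Der L Γ (some A) → Intro L Γ (dia A)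

theorem Intro.mono {L : WLogic} {Γ Γ' : Set Formula} {A : Formula} (h : Intro L Γ A)
    (hs : Γ ⊆ Γ') : Intro L Γ' A := by
  cases h with
  | var h => exact .var (hs h)
  | imp h => exact .imp (h.mono (Set.insert_subset_insert hs))
  | and h₁ h₂ => exact .and (h₁.mono hs) (h₂.mono hs)
  | or₁ h => exact .or₁ (h.mono hs)
  | or₂ h => exact .or₂ (h.mono hs)
  | box X Y hp hX hY h =>
    exact .box X Y hp (fun A hA => hs (hX A hA)) (fun A hA => hs (hY A hA)) h
  | dia X Y hp hX hY h =>
    exact .dia X Y hp (fun A hA => hs (hX A hA)) (fun A hA => hs (hY A hA)) h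
  | Tdia hT h => exact .Tdia hT (h.mono hs)

/-- Admissibility of cut on the formula `A`, with shared context. -/
def CutFor (L : WLogic) (A : Formula) : Prop :=
  ∀ (Γ : Set Formula) (Δ : Option Formula),
    Der L Γ (some A) → Der L (insert A Γ) Δ → Der L Γ Δ

/-- Induction on the derivation of the left premiss: cuts on `A` can be permuted upwards until `A` is
principal on the left. -/
theorem cutFor_of_intro {L : WLogic} {A : Formula}
    (hA : ∀ Γ Δ, Intro L Γ A → Der L (insert A Γ) Δ → Der L Γ Δ) : CutFor L A := by
  intro Γ Δ h₁ h₂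
  generalize hS : some A = S at h₁
  induction h₁ with
  | init h => cases hS; exact hA _ _ (.var h) h₂
  | botL h => exact .botL h
  | impL h h₁ _ _ ih =>
    exact .impL h h₁
      (ih (h₂.mono (Set.insert_subset_insert (Set.subset_insert _ _))) hS)
  | impR h _ => cases hS; exact hA _ _ (.imp h) h₂
  | andL h _ ih =>
    exact .andL h (ih (h₂.mono (Set.insert_subset_insert
      ((Set.subset_insert _ _).trans (Set.subset_insert _ _)))) hS)
  | andR h h' _ _ => cases hS; exact hA _ _ (.and h h') h₂
  | orL h _ _ ih₁ ih₂ =>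
    exact .orL h (ih₁ (h₂.mono (Set.insert_subset_insert (Set.subset_insert _ _))) hS)
      (ih₂ (h₂.mono (Set.insert_subset_insert (Set.subset_insert _ _))) hS)
  | orR₁ h _ => cases hS; exact hA _ _ (.or₁ h) h₂
  | orR₂ h _ => cases hS; exact hA _ _ (.or₂ h) h₂
  | modal X Y k δ hp hl hX hY h _ =>
    cases hl with
    | none => exact .modal X Y .none none hp (.none Δ) hX hY h
    | box B => cases hS; exact hA _ _ (.box X Y hp hX hY h) h₂
    | dia B => cases hS; exact hA _ _ (.dia X Y hp hX hY h) h₂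
  | Tbox hT h _ ih =>
    exact .Tbox hT h (ih (h₂.mono (Set.insert_subset_insert (Set.subset_insert _ _))) hS)
  | Tdia hT h _ => cases hS; exact hA _ _ (.Tdia hT h) h₂

/-- Cut on `□B`, principal in a modal inference on the right. -/
theorem CutFor.cut_modal_box {L : WLogic} {B : Formula} (hB : CutFor L B) {Γ : Set Formula}
    {Δ δ : Option Formula} {X Y : Finset Formula} {k : Kind} (hI : Intro L Γ (box B))
    (hp : Prof L X.card Y.card k) (hl : Lift k δ Δ) (hBX : B ∈ X)
    (hX : ∀ A ∈ X, box A ∈ insert (box B) Γ) (hY : ∀ A ∈ Y, dia A ∈ Γ)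
    (h : Der L (↑X ∪ ↑Y) δ) : Der L Γ Δ := by
  obtain _ | _ | _ | _ | _ | ⟨X', Y', hp', hX', hY', h'⟩ := hI
  have hY0 : Y' = ∅ := Finset.card_eq_zero.1 hp'.box_card_dia
  subst hY0
  have hc : (X.erase B).card = X.card - 1 := Finset.card_erase_of_mem hBX
  refine .modal (X.erase B ∪ X') Y k δ ?_ hl ?_ hY (hB _ _ (h'.mono ?_) (h.mono ?_))
  · refine hp'.comp_box hp (Finset.card_pos.2 ⟨B, hBX⟩) ?_ ?_
    · exact Finset.card_le_card Finset.subset_union_right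
    · rw [← hc]; exact Finset.card_union_le _ _
  · intro A hA
    rcases Finset.mem_union.1 hA with hA | hA
    · obtain ⟨hne, hA⟩ := Finset.mem_erase.1 hA
      exact (hX A hA).resolve_left (fun he => hne (Formula.box.inj he))
    · exact hX' A hA
  · intro A; simp +contextual
  · intro A; simp; tauto

/-- Cut on `◇B`, principal in a modal inference on the right. If `◇B` comes from `T_◇` on the left,
the cut on `B` is made in `Γ ∪ X`, and `X` is then absorbed by `T_□`. -/
theorem CutFor.cut_modal_dia {L : WLogic} {B : Formula} (hB : CutFor L B) {Γ : Set Formula}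
    {Δ δ : Option Formula} {X Y : Finset Formula} {k : Kind} (hI : Intro L Γ (dia B))
    (hp : Prof L X.card Y.card k) (hl : Lift k δ Δ) (hBY : B ∈ Y)
    (hX : ∀ A ∈ X, box A ∈ Γ) (h : Der L (↑X ∪ ↑Y) δ) : Der L Γ Δ := by
  have hY : Y = {B} := by
    obtain ⟨C, rfl⟩ := Finset.card_eq_one.1
      (le_antisymm hp.card_dia_le (Finset.card_pos.2 ⟨B, hBY⟩))
    rw [Finset.mem_singleton.1 hBY]
  subst hY
  obtain _ | _ | _ | _ | _ | _ | ⟨X', Y', hp', hX', hY', h'⟩ | ⟨hT, h'⟩ := hI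
  · refine .modal (X ∪ X') Y' k δ ?_ hl ?_ hY' (hB _ _ (h'.mono ?_) (h.mono ?_))
    · exact hp'.comp_dia hp (Finset.card_le_card Finset.subset_union_left)
        (Finset.card_le_card Finset.subset_union_right) (Finset.card_union_le _ _)
    · intro A hA
      exact (Finset.mem_union.1 hA).elim (hX A) (hX' A)
    · intro A; simp; tauto
    · intro A; simp; tauto
  · have hδ : Der L Γ δ := by
      refine .Tbox_finset (Tbox_mem_of_Tdia_mem hT) X hX (hB _ _ (h'.mono ?_) (h.mono ?_))
      · exact Set.subset_union_right
      · intro A; simp; tauto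
    cases hl with
    | none => exact hδ.weaken_succ Δ
    | box C => simp [Prof] at hp
    | dia C => exact .Tdia hT hδ

/-- Induction on the derivation of the right premiss, when the cut formula `A` is principal on the
left and cuts on smaller formulas are admissible. In the principal cases the induction hypothesis
first removes the retained copy of `A` from the premisses. -/
theorem cut_of_intro {L : WLogic} {A : Formula}
    (ih : ∀ B, sizeOf B < sizeOf A → CutFor L B) {Θ : Set Formula} {Δ : Option Formula}
    (h : Der L Θ Δ) : ∀ Γ, Θ ⊆ insert A Γ → Intro L Γ A → Der L Γ Δ := by
  have key : ∀ {Θ Γ : Set Formula} {F : Formula}, Θ ⊆ insert A Γ →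
      insert F Θ ⊆ insert A (insert F Γ) := fun hs => by
    rw [Set.insert_comm]; exact Set.insert_subset_insert hs
  induction h with
  | init h =>
    intro Γ hs hI
    rcases hs h with rfl | h
    · obtain ⟨h⟩ := hI
      exact .init h
    · exact .init h
  | botL h =>
    intro Γ hs hI
    rcases hs h with rfl | h
    · cases hI
    · exact .botL h
  | @impL _ B C _ h _ _ ih₁ ih₂ =>
    intro Γ hs hI
    have h₁ := ih₁ Γ hs hI
    have h₂ := ih₂ (insert C Γ) (key hs) (hI.mono (Set.subset_insert _ _))
    rcases hs h with rfl | h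
    · obtain _ | hI := hI
      exact ih C (by simp) _ _ (ih B (by simp; omega) _ _ h₁ hI) h₂
    · exact .impL h h₁ h₂
  | impR _ ih₁ =>
    intro Γ hs hI
    exact .impR (ih₁ _ (key hs) (hI.mono (Set.subset_insert _ _)))
  | @andL _ B C _ h _ ih₁ =>
    intro Γ hs hI
    have h₁ := ih₁ (insert B (insert C Γ)) (key (key hs))
      (hI.mono ((Set.subset_insert _ _).trans (Set.subset_insert _ _)))
    rcases hs h with rfl | h
    · obtain _ | _ | ⟨hB, hC⟩ := hI
      exact ih C (by simp) _ _ hC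
        (ih B (by simp; omega) _ _ (hB.mono (Set.subset_insert _ _)) h₁)
    · exact .andL h h₁
  | andR _ _ ih₁ ih₂ => intro Γ hs hI; exact .andR (ih₁ Γ hs hI) (ih₂ Γ hs hI)
  | @orL _ B C _ h _ _ ih₁ ih₂ =>
    intro Γ hs hI
    have h₁ := ih₁ (insert B Γ) (key hs) (hI.mono (Set.subset_insert _ _))
    have h₂ := ih₂ (insert C Γ) (key hs) (hI.mono (Set.subset_insert _ _))
    rcases hs h with rfl | h
    · obtain _ | _ | _ | hB | hC := hI
      · exact ih B (by simp; omega) _ _ hB h₁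
      · exact ih C (by simp) _ _ hC h₂
    · exact .orL h h₁ h₂
  | orR₁ _ ih₁ => intro Γ hs hI; exact .orR₁ (ih₁ Γ hs hI)
  | orR₂ _ ih₁ => intro Γ hs hI; exact .orR₂ (ih₁ Γ hs hI)
  | modal X Y k δ hp hl hX hY h _ =>
    intro Γ hs hI
    by_cases hbox : ∃ B ∈ X, box B = A
    · obtain ⟨B, hBX, rfl⟩ := hbox
      exact (ih B (by simp)).cut_modal_box hI hp hl hBX (fun C hC => hs (hX C hC))
        (fun C hC => (hs (hY C hC)).resolve_left (by simp)) h
    · have hX' : ∀ C ∈ X, box C ∈ Γ := fun C hC =>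
        (hs (hX C hC)).resolve_left (fun he => hbox ⟨C, hC, he⟩)
      by_cases hdia : ∃ B ∈ Y, dia B = A
      · obtain ⟨B, hBY, rfl⟩ := hdia
        exact (ih B (by simp)).cut_modal_dia hI hp hl hBY hX' h
      · exact .modal X Y k δ hp hl hX' (fun C hC =>
          (hs (hY C hC)).resolve_left (fun he => hdia ⟨C, hC, he⟩)) h
  | @Tbox _ B _ hT h _ ih₁ =>
    intro Γ hs hI
    have h₁ := ih₁ (insert B Γ) (key hs) (hI.mono (Set.subset_insert _ _))
    rcases hs h with rfl | h
    · obtain _ | _ | _ | _ | _ | ⟨X, Y, hp, hX, hY, h'⟩ := hI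
      have hY0 : Y = ∅ := Finset.card_eq_zero.1 hp.box_card_dia
      subst hY0
      refine .Tbox_finset hT X hX (ih B (by simp) _ _ (h'.mono ?_) (h₁.mono ?_))
      · intro C; simp +contextual
      · exact Set.insert_subset_insert Set.subset_union_right
    · exact .Tbox hT h h₁
  | Tdia hT _ ih₁ => intro Γ hs hI; exact .Tdia hT (ih₁ Γ hs hI)

theorem cutFor (L : WLogic) (A : Formula) : CutFor L A :=
  cutFor_of_intro fun Γ _ hI h =>
    cut_of_intro (fun B _ => cutFor L B) h Γ subset_rfl hI
termination_by sizeOf A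

/-! ### From multisets to sets -/

theorem ModalInst.der {L : WLogic} {r : ModalRule} {S T : Sequent} (hr : r ∈ modalRules L)
    (hi : ModalInst r S T) (h : Der L {F | F ∈ S.ante} S.succ) :
    Der L {F | F ∈ T.ante} T.succ := by
  cases hi with
  | Mbox Γ A B =>
    exact .modal {A} ∅ .box (some B) (by simp [Prof, hr]) (.box B) (by simp) (by simp)
      (h.mono (by intro F; simp))
  | Mdia Γ A B =>
    exact .modal ∅ {A} .dia (some B) (by simp [Prof, hr]) (.dia B) (by simp) (by simp)
      (h.mono (by intro F; simp))
  | dualM Γ A B Δ =>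
    exact .modal {A} {B} .none none (by simp [Prof, hr]) (.none Δ) (by simp) (by simp)
      (h.mono (by intro F; simp; tauto))
  | Nbox Γ A =>
    exact .modal ∅ ∅ .box (some A) (by simp [Prof, hr]) (.box A) (by simp) (by simp)
      (h.mono (by intro F; simp))
  | Ndia Γ A Δ =>
    exact .modal ∅ {A} .none none (by simp [Prof, hr]) (.none Δ) (by simp) (by simp)
      (h.mono (by intro F; simp))
  | Cbox Γ Γ' A B =>
    exact .modal (insert A Γ.toFinset) ∅ .box (some B) (by simp [Prof, hr, Finset.one_le_card])
      (.box B) (by simp +contextual [boxes]) (by simp) (h.mono (by intro F; simp))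
  | Cdia Γ Γ' A B =>
    exact .modal Γ.toFinset {A} .dia (some B) (by simp [Prof, hr]) (.dia B)
      (by simp +contextual [boxes]) (by simp) (h.mono (by intro F; simp))
  | dualC Γ Γ' A B Δ =>
    exact .modal (insert A Γ.toFinset) {B} .none none (by simp [Prof, hr, Finset.one_le_card])
      (.none Δ) (by simp +contextual [boxes]) (by simp) (h.mono (by intro F; simp; tauto))
  | Kbox Γ Γ' A =>
    exact .modal Γ.toFinset ∅ .box (some A) (by simp [Prof, hr]) (.box A)
      (by simp +contextual [boxes]) (by simp) (h.mono (by intro F; simp))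
  | Kdia Γ Γ' A B =>
    exact .modal Γ.toFinset {A} .dia (some B) (by simp [Prof, hr]) (.dia B)
      (by simp +contextual [boxes]) (by simp) (h.mono (by intro F; simp))
  | dualK Γ Γ' A Δ =>
    exact .modal Γ.toFinset {A} .none none (by simp [Prof, hr]) (.none Δ)
      (by simp +contextual [boxes]) (by simp) (h.mono (by intro F; simp))
  | Pbox Γ A Δ =>
    exact .modal {A} ∅ .none none (by simp [Prof, hr]) (.none Δ) (by simp) (by simp)
      (h.mono (by intro F; simp))
  | Pdia Γ A =>
    exact .modal ∅ ∅ .dia (some A) (by simp [Prof, hr]) (.dia A) (by simp) (by simp)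
      (h.mono (by intro F; simp))
  | D Γ A B =>
    exact .modal {A} ∅ .dia (some B) (by simp [Prof, hr]) (.dia B) (by simp) (by simp)
      (h.mono (by intro F; simp))
  | Dbox Γ A B Δ =>
    refine .modal {A, B} ∅ .none none ?_ (.none Δ) (by simp) (by simp)
      (h.mono (by intro F; simp))
    -- for `A = B` the set `{A, B}` has one element, and `P_□` is the applicable rule
    by_cases hAB : A = B
    · simp [Prof, hAB, Pbox_mem_of_Dbox_mem hr]
    · simp [Prof, hAB, hr]
  | CD Γ Γ' A =>
    exact .modal Γ.toFinset ∅ .dia (some A) (by simp [Prof, hr]) (.dia A)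
      (by simp +contextual [boxes]) (by simp) (h.mono (by intro F; simp))
  | CDbox Γ Γ' Δ =>
    exact .modal Γ.toFinset ∅ .none none (by simp [Prof, hr]) (.none Δ)
      (by simp +contextual [boxes]) (by simp) (h.mono (by intro F; simp))
  | Tbox Γ A Δ => exact .Tbox (A := A) hr (by simp) (h.mono (by intro F; simp))
  | Tdia Γ A => exact .Tdia hr h

theorem Derivable.der {L : WLogic} {S : Sequent} (h : Derivable L S) :
    Der L {F | F ∈ S.ante} S.succ := by
  induction h with
  | init Γ p => exact .init (by simp)
  | botL Γ Δ => exact .botL (by simp)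
  | impL Γ A B Δ _ _ ih₁ ih₂ =>
    exact .impL (A := A) (B := B) (by simp) ih₁ (ih₂.mono (by intro F; simp; tauto))
  | impR Γ A B _ ih => exact .impR (ih.mono (by intro F; simp))
  | andL Γ A B Δ _ ih =>
    exact .andL (A := A) (B := B) (by simp) (ih.mono (by intro F; simp; tauto))
  | andR Γ A B _ _ ih₁ ih₂ => exact .andR ih₁ ih₂
  | orL Γ A B Δ _ _ ih₁ ih₂ =>
    exact .orL (A := A) (B := B) (by simp) (ih₁.mono (by intro F; simp; tauto))
      (ih₂.mono (by intro F; simp; tauto))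
  | orR₁ Γ A B _ ih => exact .orR₁ ih
  | orR₂ Γ A B _ ih => exact .orR₂ ih
  | modal r S T hr hi _ ih => exact hi.der hr ih

/-! ### From sets to multisets -/

/-- `Covers Γ F`: some sequence of left rule applications, each followed by a choice of a premiss
(for `→`, the right one), decomposes `F` into formulas of `Γ`. Variables, `⊥` and modal formulas
are covered only by being members. -/
inductive Covers (Γ : Multiset Formula) : Formula → Prop
  | mem {F : Formula} : F ∈ Γ → Covers Γ F
  | imp {A B : Formula} : Covers Γ B → Covers Γ (imp A B)
  | and {A B : Formula} : Covers Γ A → Covers Γ B → Covers Γ (and A B)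
  | or₁ {A B : Formula} : Covers Γ A → Covers Γ (or A B)
  | or₂ {A B : Formula} : Covers Γ B → Covers Γ (or A B)

theorem Covers.trans {Γ Γ' : Multiset Formula} {F : Formula} (h : Covers Γ F)
    (hΓ : ∀ G ∈ Γ, Covers Γ' G) : Covers Γ' F := by
  induction h with
  | mem h => exact hΓ _ h
  | imp _ ih => exact .imp ih
  | and _ _ ih₁ ih₂ => exact .and ih₁ ih₂
  | or₁ _ ih => exact .or₁ ih
  | or₂ _ ih => exact .or₂ ih

theorem Covers.cons {Γ : Multiset Formula} {F : Formula} (h : Covers Γ F) (G : Formula) :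
    Covers (G ::ₘ Γ) F :=
  h.trans fun _ hH => .mem (Multiset.mem_cons_of_mem hH)

/-- Going up through a left rule, the principal formula `G` may be replaced in a covering multiset
by active formulas `Γ'` covering it. -/
theorem Covers.replace {Γ Γ' : Multiset Formula} {F G : Formula} (h : Covers (G ::ₘ Γ) F)
    (hG : Covers (Γ' + Γ) G) : Covers (Γ' + Γ) F :=
  h.trans fun H hH => by
    rcases Multiset.mem_cons.1 hH with rfl | hH
    · exact hG
    · exact .mem (Multiset.mem_add.2 (.inr hH))

/-- Every instance of the merged modal rule is an instance of a modal rule of the calculus, except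
for the one with empty premiss, which is the subject of the hypothesis `h₀`. -/
theorem derivable_modal {L : WLogic} {X Y : Finset Formula} {k : Kind} {δ Δ : Option Formula}
    {Γ : Multiset Formula} (hp : Prof L X.card Y.card k) (hl : Lift k δ Δ)
    (hX : ∀ A ∈ X, box A ∈ Γ) (hY : ∀ A ∈ Y, dia A ∈ Γ)
    (h : Derivable L ⟨X.val + Y.val, δ⟩) (h₀ : X = ∅ → Y = ∅ → δ = none → Derivable L ⟨Γ, Δ⟩) :
    Derivable L ⟨Γ, Δ⟩ := by
  -- `X` and `Y` have no repetitions, so membership of each formula suffices for inclusion as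
  -- multisets.
  have hle : Y.val.map dia + boxes X.val ≤ Γ := by
    refine (Multiset.le_iff_subset ?_).2 ?_
    · refine (Multiset.nodup_add).2 ⟨Y.nodup.map fun _ _ => Formula.dia.inj,
        X.nodup.map fun _ _ => Formula.box.inj, ?_⟩
      rw [Multiset.disjoint_left]
      simp [boxes]
    · intro F hF
      simp only [boxes, Multiset.mem_add, Multiset.mem_map, Finset.mem_val] at hF
      rcases hF with ⟨A, hA, rfl⟩ | ⟨A, hA, rfl⟩
      · exact hY A hA
      · exact hX A hA
  obtain ⟨R, rfl⟩ := Multiset.le_iff_exists_add.1 hle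
  clear hle hX hY
  obtain rfl | ⟨B, rfl⟩ : Y = ∅ ∨ ∃ B, Y = {B} := by
    have := hp.card_dia_le
    rcases Nat.le_one_iff_eq_zero_or_eq_one.1 this with h | h
    · exact .inl (Finset.card_eq_zero.1 h)
    · exact .inr (Finset.card_eq_one.1 h)
  · cases hl with
    | box A =>
      simp only [Finset.card_empty, Finset.empty_val, Multiset.map_zero, zero_add,
        add_zero] at hp h ⊢
      rcases hp with ⟨hr, hm⟩ | ⟨hr, hm⟩ | ⟨hr, hm⟩ | hr
      · obtain ⟨C, rfl⟩ := Finset.card_eq_one.1 hm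
        exact .modal _ _ _ hr (.Mbox R C A) h
      · obtain rfl := Finset.card_eq_zero.1 hm
        exact .modal _ _ _ hr (.Nbox _ A) h
      · obtain ⟨C, hC⟩ := Finset.card_pos.1 hm
        obtain ⟨Z, hZ⟩ := Multiset.exists_cons_of_mem hC
        rw [hZ] at h ⊢
        simpa [boxes] using Derivable.modal _ _ _ hr (.Cbox Z R C A) h
      · exact .modal _ _ _ hr (.Kbox X.val R A) h
    | dia A =>
      simp only [Finset.card_empty, Finset.empty_val, Multiset.map_zero, zero_add,
        add_zero] at hp h ⊢
      rcases hp with ⟨hr, hm⟩ | ⟨hr, hm⟩ | hr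
      · obtain rfl := Finset.card_eq_zero.1 hm
        exact .modal _ _ _ hr (.Pdia _ A) h
      · obtain ⟨C, rfl⟩ := Finset.card_eq_one.1 hm
        exact .modal _ _ _ hr (.D R C A) h
      · exact .modal _ _ _ hr (.CD X.val R A) h
    | none =>
      simp only [Finset.card_empty, Finset.empty_val, Multiset.map_zero, zero_add,
        add_zero] at hp h h₀ ⊢
      rcases hp with hm | ⟨hr, hm⟩ | ⟨hr, hm⟩ | hr
      · exact h₀ (Finset.card_eq_zero.1 hm) trivial trivial
      · obtain ⟨C, rfl⟩ := Finset.card_eq_one.1 hm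
        exact .modal _ _ _ hr (.Pbox R C Δ) h
      · obtain ⟨C, D, hCD, rfl⟩ := Finset.card_eq_two.1 hm
        have hv : ({C, D} : Finset Formula).val = {C, D} := by
          rw [Finset.insert_val_of_notMem (by simpa using hCD)]; rfl
        rw [hv] at h ⊢
        simpa [boxes] using Derivable.modal _ _ _ hr (.Dbox R C D Δ) h
      · exact .modal _ _ _ hr (.CDbox X.val R Δ) h
  · have hB : X.val + ({B} : Finset Formula).val = B ::ₘ X.val := by
      rw [Finset.singleton_val, add_comm, Multiset.singleton_add]
    have hB' : Multiset.map dia ({B} : Finset Formula).val + boxes X.val + R =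
        dia B ::ₘ (boxes X.val + R) := by
      simp
    rw [hB] at h
    rw [hB'] at h₀ ⊢
    cases hl with
    | box A => simp [Prof] at hp
    | dia A =>
      rcases hp with ⟨hr, hm⟩ | hr | hr
      · obtain rfl := Finset.card_eq_zero.1 hm
        exact .modal _ _ _ hr (.Mdia _ B A) h
      · exact .modal _ _ _ hr (.Cdia X.val R B A) h
      · exact .modal _ _ _ hr (.Kdia X.val R B A) h
    | none =>
      rcases hp with ⟨hr, hm⟩ | ⟨hr, hm⟩ | ⟨hr, hm⟩ | hr
      · obtain ⟨C, rfl⟩ := Finset.card_eq_one.1 hm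
        have h' : Derivable L ⟨{C, B}, none⟩ := by
          rwa [Multiset.pair_comm]
        simpa [boxes, Multiset.cons_swap] using Derivable.modal _ _ _ hr (.dualM R C B Δ) h'
      · obtain rfl := Finset.card_eq_zero.1 hm
        exact .modal _ _ _ hr (.Ndia _ B Δ) h
      · obtain ⟨C, hC⟩ := Finset.card_pos.1 hm
        obtain ⟨Z, hZ⟩ := Multiset.exists_cons_of_mem hC
        rw [hZ] at h ⊢
        rw [Multiset.cons_swap] at h
        have := Derivable.modal _ _ _ hr (.dualC Z R C B Δ) h
        rw [Multiset.cons_swap] at this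
        simpa [boxes] using this
      · exact .modal _ _ _ hr (.dualK X.val R B Δ) h

/-- The covering relation makes both contraction and inversion unnecessary: a left rule is applied
if its principal formula occurs in `Γ'`, and is skipped if that formula is already decomposed. The
disjunction `Δ = none ∨ Δ = Δ'` builds in weakening on the right. -/
theorem Der.derivable {L : WLogic} {Γ : Set Formula} {Δ : Option Formula} (h : Der L Γ Δ) :
    ∀ (Γ' : Multiset Formula) (Δ' : Option Formula), (∀ F ∈ Γ, Covers Γ' F) →
      (Δ = none ∨ Δ = Δ') → Derivable L ⟨Γ', Δ'⟩ := by
  induction h with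
  | @init _ p h =>
    rintro Γ' Δ' hΓ (h' | rfl)
    · cases h'
    · obtain ⟨h⟩ := hΓ _ h
      obtain ⟨R, rfl⟩ := Multiset.exists_cons_of_mem h
      exact .init R p
  | botL h =>
    intro Γ' Δ' hΓ hΔ
    obtain ⟨h⟩ := hΓ _ h
    obtain ⟨R, rfl⟩ := Multiset.exists_cons_of_mem h
    exact .botL R Δ'
  | @impL _ A B _ h _ _ ih₁ ih₂ =>
    intro Γ' Δ' hΓ hΔ
    obtain h | h := hΓ _ h
    · obtain ⟨R, rfl⟩ := Multiset.exists_cons_of_mem h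
      refine .impL R A B Δ' (ih₁ _ _ hΓ (.inr rfl)) (ih₂ _ _ ?_ hΔ)
      have hB : Covers ({B} + R) B := .mem (by simp)
      rintro F (rfl | hF)
      · exact hB
      · exact (hΓ F hF).replace (Γ' := {B}) (.imp hB)
    · exact ih₂ _ _ (Set.forall_mem_insert.2 ⟨h, hΓ⟩) hΔ
  | @impR _ A B _ ih =>
    rintro Γ' Δ' hΓ (h' | rfl)
    · cases h'
    · exact .impR Γ' A B (ih _ _ (Set.forall_mem_insert.2
        ⟨.mem (by simp), fun F hF => (hΓ F hF).cons A⟩) (.inr rfl))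
  | @andL _ A B _ h _ ih =>
    intro Γ' Δ' hΓ hΔ
    obtain h | _ | ⟨hA, hB⟩ := hΓ _ h
    · obtain ⟨R, rfl⟩ := Multiset.exists_cons_of_mem h
      have hA : Covers ({A, B} + R) A := .mem (by simp)
      have hB : Covers ({A, B} + R) B := .mem (by simp)
      have := ih ({A, B} + R) Δ' (by
        rintro F (rfl | rfl | hF)
        · exact hA
        · exact hB
        · exact (hΓ F hF).replace (.and hA hB)) hΔ
      exact .andL R A B Δ' (by simpa using this)
    · exact ih _ _ (Set.forall_mem_insert.2 ⟨hA, Set.forall_mem_insert.2 ⟨hB, hΓ⟩⟩) hΔ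
  | @andR _ A B _ _ ih₁ ih₂ =>
    rintro Γ' Δ' hΓ (h' | rfl)
    · cases h'
    · exact .andR Γ' A B (ih₁ _ _ hΓ (.inr rfl)) (ih₂ _ _ hΓ (.inr rfl))
  | @orL _ A B _ h _ _ ih₁ ih₂ =>
    intro Γ' Δ' hΓ hΔ
    obtain h | _ | _ | h | h := hΓ _ h
    · obtain ⟨R, rfl⟩ := Multiset.exists_cons_of_mem h
      have hA : Covers ({A} + R) A := .mem (by simp)
      have hB : Covers ({B} + R) B := .mem (by simp)
      refine .orL R A B Δ' (ih₁ _ _ ?_ hΔ) (ih₂ _ _ ?_ hΔ)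
      · exact Set.forall_mem_insert.2 ⟨hA, fun F hF => (hΓ F hF).replace (Γ' := {A}) (.or₁ hA)⟩
      · exact Set.forall_mem_insert.2 ⟨hB, fun F hF => (hΓ F hF).replace (Γ' := {B}) (.or₂ hB)⟩
    · exact ih₁ _ _ (Set.forall_mem_insert.2 ⟨h, hΓ⟩) hΔ
    · exact ih₂ _ _ (Set.forall_mem_insert.2 ⟨h, hΓ⟩) hΔ
  | @orR₁ _ A B _ ih =>
    rintro Γ' Δ' hΓ (h' | rfl)
    · cases h'
    · exact .orR₁ Γ' A B (ih _ _ hΓ (.inr rfl))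
  | @orR₂ _ A B _ ih =>
    rintro Γ' Δ' hΓ (h' | rfl)
    · cases h'
    · exact .orR₂ Γ' A B (ih _ _ hΓ (.inr rfl))
  | modal X Y k δ hp hl hX hY h ih =>
    intro Γ' Δ' hΓ hΔ
    have hl' : Lift k δ Δ' := by
      rcases hΔ with rfl | rfl
      · cases hl; exact .none Δ'
      · exact hl
    refine derivable_modal hp hl' ?_ ?_ (ih _ _ ?_ (.inr rfl)) ?_
    · intro A hA
      obtain ⟨h⟩ := hΓ _ (hX A hA)
      exact h
    · intro A hA
      obtain ⟨h⟩ := hΓ _ (hY A hA)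
      exact h
    · intro F hF
      exact .mem (by simpa using hF)
    · rintro rfl rfl rfl
      exact ih Γ' Δ' (by simp) (.inl rfl)
  | @Tbox _ A _ hT h _ ih =>
    intro Γ' Δ' hΓ hΔ
    obtain ⟨h⟩ := hΓ _ h
    obtain ⟨R, rfl⟩ := Multiset.exists_cons_of_mem h
    exact .modal _ _ _ hT (.Tbox R A Δ') (ih _ _ (Set.forall_mem_insert.2
      ⟨.mem (by simp), fun F hF => (hΓ F hF).cons A⟩) hΔ)
  | @Tdia _ A hT _ ih =>
    rintro Γ' Δ' hΓ (h' | rfl)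
    · cases h'
    · exact .modal _ _ _ hT (.Tdia Γ' A) (ih _ _ hΓ (.inr rfl))

end WCalculus

theorem mainTheorem3 (L : WCalculus.WLogic) : WCalculus.Admissible L WCalculus.Cut := by
  rintro P T ⟨Γ, Γ', A, Δ⟩ hP
  have h₁ := (hP ⟨Γ, some A⟩ (by simp)).der
  have h₂ := (hP ⟨A ::ₘ Γ', Δ⟩ (by simp)).der
  refine (WCalculus.cutFor L A {F | F ∈ Γ + Γ'} Δ (h₁.mono ?_) (h₂.mono ?_)).derivable _ _
    (fun F hF => .mem hF) (.inr rfl)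
  · intro F hF
    exact Multiset.mem_add.2 (.inl hF)
  · intro F hF
    exact (Multiset.mem_cons.1 hF).imp id fun hF => Multiset.mem_add.2 (.inr hF)
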